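/- Let $n\ge 1$, and let all graphs be finite and simple. The degree partition of a graph on the vertex set $[n]=\{1,\dots,n\}$ is its degree sequence rearranged in weakly decreasing order (zero entries are kept). Let $\mathsf{DP}(n)\subset\mathbb R^n$ be the convex hull of the degree partitions of all $n$-vertex graphs. A graph is threshold if each of its nonempty induced subgraphs has a dominating vertex (one adjacent to all other vertices of the subgraph) or an isolated vertex; let $TP(n)\subset\mathbb R^n$ be the set of degree partitions of $n$-vertex threshold graphs. Let $\mathsf F(n)\subset\mathbb R^n$ be the Fulkerson–Hoffman–McAndrew polytope, i.e. the set of all $x\in\mathbb R^n$ with $x_1\ge x_2\ge\cdots\ge x_n$ and $$\sum_{i=1}^{k}x_i-\sum_{i=n-l+1}^{n}x_i\le k(n-1-l)\qquad\text{for all integers } k,l\ge 0 \text{ with } 1\le k+l\le n$$ (there are $n(n+3)/2$ such pairs $(k,l)$). Let $S(n)$ be the set of pairs $(i,j)$ with $1\le i<j\le n$, ordered by $(i,j)\le(i',j')$ iff $i\le i'$ and $j\le j'$. Let $\mathsf S(n)\subset\mathbb R^{S(n)}$ be its order polytope, the set of $y\in[0,1]^{S(n)}$ with $y_p\ge y_q$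 whenever $p<q$, and let $M(n)$ be the $n\times\binom n2$ matrix whose column indexed by $(i,j)\in S(n)$ is the characteristic vector of $\{i,j\}\subseteq[n]$. Then: 1. $\mathsf{DP}(n)=\mathsf F(n)$, and the number of pairs $(k,l)$ above is $n(n+3)/2$, so $\mathsf F(n)$ is given by quadratically many inequalities. 2. The set of extreme points of $\mathsf{DP}(n)=\mathsf F(n)$ is exactly $TP(n)$, and it has $2^{n-1}$ elements. 3. The image of $\mathsf S(n)$ under the linear map $y\mapsto M(n)y$ is $\mathsf{DP}(n)$. -/

import Mathlib

namespace DegreePartition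

/-- `G` is threshold: every (nonempty) induced subgraph of `G` has a vertex adjacent to all its
other vertices (dominating), or a vertex adjacent to none of its vertices (isolated). -/
def IsThreshold {V : Type*} (G : SimpleGraph V) : Prop :=
  ∀ s : Set V, s.Nonempty →
    ∃ v : s, (G.induce s).IsUniversal v ∨ (G.induce s).IsIsolated v

open Classical in
/-- `d` is the degree partition of `G`: the rearrangement of the degree sequence of `G` in weakly
decreasing order. -/
def IsDegreePartition {n : ℕ} (G : SimpleGraph (Fin n)) (d : Fin n → ℕ) : Prop :=
  Antitone d ∧ ∃ σ : Equiv.Perm (Fin n), ∀ i, d i = G.degree (σ i)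

/-- The set `DP(n)` of all degree partitions of `n`-vertex simple graphs, as points of `ℝⁿ`. -/
def degreePartitions (n : ℕ) : Set (Fin n → ℝ) :=
  {x | ∃ (G : SimpleGraph (Fin n)) (d : Fin n → ℕ), IsDegreePartition G d ∧ ∀ i, x i = d i}

/-- The set `TP(n)` of all degree partitions of `n`-vertex threshold graphs, as points of `ℝⁿ`. -/
def thresholdPartitions (n : ℕ) : Set (Fin n → ℝ) :=
  {x | ∃ (G : SimpleGraph (Fin n)) (d : Fin n → ℕ),
    IsThreshold G ∧ IsDegreePartition G d ∧ ∀ i, x i = d i}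

/-- The polytope of degree partitions. -/
def degreePartitionPolytope (n : ℕ) : Set (Fin n → ℝ) :=
  convexHull ℝ (degreePartitions n)

/-- The pairs `(k, l)` of natural numbers with `1 ≤ k + l ≤ n`. -/
def fhmIndices (n : ℕ) : Finset (ℕ × ℕ) :=
  (Finset.range (n + 1) ×ˢ Finset.range (n + 1)).filter
    fun p => 1 ≤ p.1 + p.2 ∧ p.1 + p.2 ≤ n

/-- The Fulkerson–Hoffman–McAndrew polytope. Coordinates are numbered from `0`, so the first `k`
coordinates are those with `i < k`, and the last `l` are those with `n ≤ i + l`. -/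
def fhmPolytope (n : ℕ) : Set (Fin n → ℝ) :=
  {x | (∀ i j : Fin n, i ≤ j → x j ≤ x i) ∧
    ∀ p ∈ fhmIndices n,
      (∑ i : Fin n with i.val < p.1, x i) - (∑ i : Fin n with n ≤ i.val + p.2, x i)
        ≤ (p.1 : ℝ) * ((n : ℝ) - 1 - (p.2 : ℝ))}

/-- The order polytope of a poset (with the order-reversing convention). -/
def orderPolytope (P : Type*) [PartialOrder P] : Set (P → ℝ) :=
  {x | (∀ p q : P, p < q → x q ≤ x p) ∧ ∀ p : P, 0 ≤ x p ∧ x p ≤ 1}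

/-- The 2-subsets of `[n]`, written as pairs `(i, j)` with `i < j`; the order is the one inherited
from the product, i.e. the componentwise order. -/
abbrev TwoSubset (n : ℕ) : Type := {p : Fin n × Fin n // p.1 < p.2}

/-- The `n × (n choose 2)` incidence matrix of singletons vs. doubletons in `[n]`. -/
def incidenceMatrix (n : ℕ) : Matrix (Fin n) (TwoSubset n) ℝ :=
  Matrix.of fun i e => if i = e.val.1 ∨ i = e.val.2 then 1 else 0

end DegreePartition

/-! For a linear functional `c`, the maximum over all degree sequences is attained at the graph in
which `i` and `j` are adjacent when `c i + c j > 0`. This maximum is additive when the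
sign vector of `c`, scaled by the least nonzero `|c i|`, is peeled off `c`, and for sign vectors it
is the right-hand side of one of Koren's inequalities. So these inequalities bound every linear
functional.

On weakly decreasing vectors, `c` is bounded by its isotonic regression `p` (its projection to the
cone of weakly decreasing vectors). The graph of `p` is shifted, and as its degrees are constant on
the level sets of `p`, they have the same pairing with `c` as with `p`. Hence, by separation,
`fhmPolytope n` is the convex hull of the degree sequences of shifted graphs. A threshold graph is
the unique maximiser of a suitable functional, so that its degree partition is a vertex and
determines the graph; shifted graphs are threshold, and arise by successively adding a dominating
first vertex or an isolated last one, which yields the number of vertices.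

Points of the order polytope are shifted graphs with fractional edge weights, and Koren's
inequalities hold for the degrees of fractional graphs as well. -/

namespace DegreePartition

open Filter Topology Matrix

section ConvexGeometry

theorem mem_extremePoints_convexHull_of_forall_lt {𝕜 E : Type*} [Field 𝕜] [LinearOrder 𝕜]
    [IsStrictOrderedRing 𝕜] [AddCommGroup E] [Module 𝕜 E] (f : E →ₗ[𝕜] 𝕜) {s : Set E} {x : E}
    (hx : x ∈ s) (hf : ∀ y ∈ s, y ≠ x → f y < f x) :
    x ∈ Set.extremePoints 𝕜 (convexHull 𝕜 s) := by
  have hcombo {y z : E} {a b : 𝕜} (ha : 0 < a) (hb : 0 < b) (hab : a + b = 1)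
      (hy : f y ≤ f x) (hz : f z ≤ f x) (hlt : f y < f x ∨ f z < f x) :
      f (a • y + b • z) < f x := by
    have hxx : f x = a * f x + b * f x := by rw [← add_mul, hab, one_mul]
    rw [map_add, map_smul, map_smul, smul_eq_mul, smul_eq_mul, hxx]
    rcases hlt with hlt | hlt
    · exact add_lt_add_of_lt_of_le (by gcongr) (by gcongr)
    · exact add_lt_add_of_le_of_lt (by gcongr) (by gcongr)
  have hconv : Convex 𝕜 {y | y = x ∨ f y < f x} := by
    rw [convex_iff_forall_pos]
    rintro y hy z hz a b ha hb hab
    rcases hy with rfl | hy <;> rcases hz with rfl | hz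
    · exact .inl (Convex.combo_self hab _)
    · exact .inr (hcombo ha hb hab le_rfl hz.le (.inr hz))
    · exact .inr (hcombo ha hb hab hy.le le_rfl (.inl hy))
    · exact .inr (hcombo ha hb hab hy.le hz.le (.inl hy))
  have hhull : ∀ y ∈ convexHull 𝕜 s, y = x ∨ f y < f x :=
    convexHull_min (fun y hy => or_iff_not_imp_left.mpr (hf y hy)) hconv
  rw [mem_extremePoints_iff_left]
  refine ⟨subset_convexHull 𝕜 s hx, ?_⟩
  rintro y hy z hz ⟨a, b, ha, hb, hab, hcomb⟩
  refine (hhull y hy).resolve_right fun hlt => ?_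
  have hz' : f z ≤ f x := (hhull z hz).elim (fun h => h ▸ le_rfl) le_of_lt
  exact (hcombo ha hb hab hlt.le hz' (.inl hlt)).ne (congrArg f hcomb)

theorem mem_of_forall_exists_dotProduct_le {ι : Type*} [Fintype ι] {s : Set (ι → ℝ)} {x : ι → ℝ}
    (hconv : Convex ℝ s) (hclosed : IsClosed s) (h : ∀ c : ι → ℝ, ∃ y ∈ s, c ⬝ᵥ x ≤ c ⬝ᵥ y) :
    x ∈ s := by
  classical
  by_contra hx
  obtain ⟨f, u, hs, hu⟩ := geometric_hahn_banach_closed_point hconv hclosed hx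
  obtain ⟨c, hc⟩ := (dotProductEquiv ℝ ι).surjective f.toLinearMap
  have hf (z : ι → ℝ) : c ⬝ᵥ z = f z := LinearMap.congr_fun hc z
  obtain ⟨y, hy, hle⟩ := h c
  rw [hf, hf] at hle
  exact (hu.trans_le hle).not_gt (hs y hy)

end ConvexGeometry

section IsotonicRegression

variable {ι : Type*} [Preorder ι]

theorem eventually_antitone_add_smul [Finite ι] {p d : ι → ℝ} (hp : Antitone p)
    (hd : ∀ i j, p i = p j → d i = d j) : ∀ᶠ ε : ℝ in 𝓝 0, Antitone (p + ε • d) := by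
  have hpair (i j : ι) (hij : i ≤ j) : ∀ᶠ ε : ℝ in 𝓝 0, (p + ε • d) j ≤ (p + ε • d) i := by
    simp only [Pi.add_apply, Pi.smul_apply, smul_eq_mul]
    rcases (hp hij).eq_or_lt with heq | hlt
    · exact .of_forall fun ε => by rw [heq, hd j i heq]
    · have hlim (k : ι) : Tendsto (fun ε : ℝ => p k + ε * d k) (𝓝 0) (𝓝 (p k)) :=
        Continuous.tendsto' (by fun_prop) _ _ (by simp)
      exact ((hlim j).eventually_lt (hlim i) hlt).mono fun _ => le_of_lt
  filter_upwards [eventually_all.mpr fun i => eventually_all.mpr fun j =>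
    eventually_all.mpr (hpair i j)] with ε hε i j hij using hε i j hij

variable [Fintype ι]

theorem exists_antitone_dotProduct_sub_nonpos (c : ι → ℝ) :
    ∃ p : ι → ℝ, Antitone p ∧ ∀ x, Antitone x → (c - p) ⬝ᵥ (x - p) ≤ 0 := by
  let K : Set (EuclideanSpace ℝ ι) := {z | Antitone z.ofLp}
  have hne : K.Nonempty := ⟨0, fun _ _ _ => le_rfl⟩
  have hconv : Convex ℝ K := fun x hx y hy a b ha hb _ =>
    (hx.const_mul ha).add (hy.const_mul hb)
  have hclosed : IsClosed K := isClosed_antitone.preimage (PiLp.continuous_ofLp 2 _)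
  obtain ⟨p, hp, hmin⟩ := exists_norm_eq_iInf_of_complete_convex
    hne hclosed.isComplete hconv (WithLp.toLp 2 c)
  refine ⟨p.ofLp, hp, fun x hx => ?_⟩
  have := (norm_eq_iInf_iff_real_inner_le_zero hconv hp).mp hmin (WithLp.toLp 2 x) hx
  rwa [EuclideanSpace.inner_eq_star_dotProduct, star_trivial, dotProduct_comm] at this

theorem exists_antitone_dotProduct_le (c : ι → ℝ) :
    ∃ p : ι → ℝ, Antitone p ∧ (∀ x, Antitone x → c ⬝ᵥ x ≤ p ⬝ᵥ x) ∧
      ∀ d : ι → ℝ, (∀ i j, p i = p j → d i = d j) → c ⬝ᵥ d = p ⬝ᵥ d := by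
  obtain ⟨p, hp, hproj⟩ := exists_antitone_dotProduct_sub_nonpos c
  refine ⟨p, hp, fun x hx => ?_, fun d hd => ?_⟩
  · have := hproj (p + x) (hp.add hx)
    rwa [add_sub_cancel_left, sub_dotProduct, sub_nonpos] at this
  · have hmax : IsLocalMax (fun ε : ℝ => ε * ((c - p) ⬝ᵥ d)) 0 := by
      filter_upwards [eventually_antitone_add_smul hp hd] with ε hε
      simpa [dotProduct_smul] using hproj _ hε
    rw [← sub_eq_zero, ← sub_dotProduct]
    exact hmax.hasDerivAt_eq_zero (by simpa using (hasDerivAt_id (0 : ℝ)).mul_const _)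

end IsotonicRegression

section Sums

/-- Induction on the number of nonzero entries: a vector is reduced by moving all of them towards
zero by the least of their absolute values. -/
theorem sign_induction {ι R : Type*} [Finite ι] [Ring R] [LinearOrder R] [IsStrictOrderedRing R]
    {P : (ι → R) → Prop} (zero : P 0)
    (step : ∀ (c : ι → R) (m : R), 0 ≤ m → (∀ i, c i = 0 ∨ m ≤ |c i|) →
      P (fun i => c i - m * SignType.sign (c i)) → P c) (c : ι → R) : P c := by
  cases nonempty_fintype ι
  induction h : ({i | c i ≠ 0} : Finset ι) using Finset.strongInduction generalizing c with
  | H s ih =>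
    subst h
    rcases ({i | c i ≠ 0} : Finset ι).eq_empty_or_nonempty with hs | hs
    · have hc : c = 0 := funext fun i => by
        simpa using Finset.filter_eq_empty_iff.mp hs (Finset.mem_univ i)
      exact hc ▸ zero
    obtain ⟨a, ha, hmin⟩ := Finset.exists_min_image _ (fun i => |c i|) hs
    refine step c |c a| (abs_nonneg _) (fun i => ?_) (ih _ ?_ _ rfl)
    · exact or_iff_not_imp_left.mpr fun hi => hmin i (by simpa using hi)
    · refine Finset.ssubset_iff_of_subset (fun i => ?_) |>.mpr ⟨a, ha, by simp⟩
      simp only [Finset.mem_filter_univ]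
      exact mt fun hi => by simp [hi]

theorem sum_le_sum_of_card_eq {ι M : Type*} [AddCommMonoid M] [PartialOrder M]
    [IsOrderedCancelAddMonoid M] [DecidableEq ι] {f : ι → M} {s t : Finset ι}
    (hcard : s.card = t.card) (h : ∀ i ∈ s \ t, ∀ j ∈ t \ s, f i ≤ f j) :
    ∑ i ∈ s, f i ≤ ∑ i ∈ t, f i := by
  rw [← Finset.sum_sdiff_le_sum_sdiff]
  have e : (s \ t : Finset ι) ≃ (t \ s : Finset ι) :=
    Finset.equivOfCardEq (Finset.card_sdiff_comm hcard)
  rw [← Finset.sum_coe_sort, ← Finset.sum_coe_sort (t \ s), ← e.sum_comp]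
  exact Finset.sum_le_sum fun i _ => h i i.2 (e i) (e i).2

theorem sum_le_sum_filter_lt_card {M : Type*} [AddCommMonoid M] [PartialOrder M]
    [IsOrderedCancelAddMonoid M] {n : ℕ} {x : Fin n → M} (hx : Antitone x) (A : Finset (Fin n)) :
    ∑ i ∈ A, x i ≤ ∑ i : Fin n with i.val < A.card, x i := by
  have hA : A.card ≤ n := by simpa using A.card_le_univ
  refine sum_le_sum_of_card_eq (by simp [Fin.card_filter_val_lt, hA]) fun i hi j hj => hx ?_
  simp only [Finset.mem_sdiff, Finset.mem_filter_univ] at hi hj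
  exact Fin.le_def.mpr (by omega)

theorem card_filter_le_val_add {n l : ℕ} (hl : l ≤ n) :
    Finset.card {i : Fin n | n ≤ i.val + l} = l := by
  have h := Finset.card_compl {i : Fin n | i.val < n - l}
  rw [Fin.card_filter_val_lt, Fintype.card_fin, Finset.compl_filter] at h
  rw [Finset.filter_congr (q := fun i : Fin n => ¬ i.val < n - l) fun i _ => by omega]
  omega

theorem sum_filter_le_add_card_le_sum {M : Type*} [AddCommMonoid M] [PartialOrder M]
    [IsOrderedCancelAddMonoid M] {n : ℕ} {x : Fin n → M} (hx : Antitone x) (B : Finset (Fin n)) :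
    ∑ i : Fin n with n ≤ i.val + B.card, x i ≤ ∑ i ∈ B, x i := by
  have hB : B.card ≤ n := by simpa using B.card_le_univ
  refine sum_le_sum_of_card_eq (card_filter_le_val_add hB) fun i hi j hj => hx ?_
  simp only [Finset.mem_sdiff, Finset.mem_filter_univ] at hi hj
  exact Fin.le_def.mpr (by omega)

end Sums

section Koren

variable {V : Type*} [Fintype V]

variable (V) in
/-- The polytope of degree sequences on the vertex set `V`, given by Koren's inequalities. -/
def korenPolytope : Set (V → ℝ) :=
  {x | ∀ A B : Finset V, Disjoint A B →
    ∑ i ∈ A, x i - ∑ i ∈ B, x i ≤ A.card * (Fintype.card V - 1 - B.card)}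

theorem convex_korenPolytope : Convex ℝ (korenPolytope V) := by
  intro x hx y hy a b ha hb hab A B hAB
  have hx' := mul_le_mul_of_nonneg_left (hx A B hAB) ha
  have hy' := mul_le_mul_of_nonneg_left (hy A B hAB) hb
  simp only [Pi.add_apply, Pi.smul_apply, smul_eq_mul, Finset.sum_add_distrib, ← Finset.mul_sum]
  calc _ = a * (∑ i ∈ A, x i - ∑ i ∈ B, x i) + b * (∑ i ∈ A, y i - ∑ i ∈ B, y i) := by ring
    _ ≤ _ := add_le_add hx' hy'
    _ = _ := by rw [← add_mul, hab, one_mul]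

theorem mem_fhmPolytope_iff {n : ℕ} {x : Fin n → ℝ} :
    x ∈ fhmPolytope n ↔ Antitone x ∧ x ∈ korenPolytope (Fin n) := by
  refine and_congr_right fun hx => ⟨fun h A B hAB => ?_, fun h ⟨k, l⟩ hp => ?_⟩
  · rcases (A.card + B.card).eq_zero_or_pos with h0 | hpos
    · obtain ⟨hA, hB⟩ := Nat.add_eq_zero_iff.mp h0
      simp [Finset.card_eq_zero.mp hA, Finset.card_eq_zero.mp hB]
    have hle : A.card + B.card ≤ n := by
      simpa [Finset.card_union_of_disjoint hAB] using (A ∪ B).card_le_univ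
    have hp : (A.card, B.card) ∈ fhmIndices n := by
      simp only [fhmIndices, Finset.mem_filter, Finset.mem_product, Finset.mem_range]
      omega
    rw [Fintype.card_fin]
    exact (sub_le_sub (sum_le_sum_filter_lt_card hx A)
      (sum_filter_le_add_card_le_sum hx B)).trans (h _ hp)
  · simp only [fhmIndices, Finset.mem_filter, Finset.mem_product, Finset.mem_range] at hp
    have hdisj : Disjoint (Finset.univ.filter fun i : Fin n => i.val < k)
        (Finset.univ.filter fun i => n ≤ i.val + l) :=
      Finset.disjoint_filter.mpr fun i _ => by omega
    have hkl := h _ _ hdisj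
    rwa [Fin.card_filter_val_lt, min_eq_right (by omega), card_filter_le_val_add (by omega),
      Fintype.card_fin] at hkl

theorem convex_fhmPolytope (n : ℕ) : Convex ℝ (fhmPolytope n) := by
  have h : fhmPolytope n = {x | Antitone x} ∩ korenPolytope (Fin n) :=
    Set.ext fun _ => mem_fhmPolytope_iff
  rw [h]
  exact Convex.inter (fun x hx y hy a b ha hb _ => (hx.const_mul ha).add (hy.const_mul hb))
    convex_korenPolytope

end Koren

section FractionalGraphs

variable {V : Type*}

/-- A fractional graph: a weighted graph with edge weights in `[0, 1]`, encoded by its adjacency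
matrix. The vector of its (fractional) degrees is the product with the all-ones vector. -/
structure IsFractionalGraph (w : Matrix V V ℝ) : Prop where
  symm : ∀ i j, w i j = w j i
  diag : ∀ i, w i i = 0
  nonneg : ∀ i j, 0 ≤ w i j
  le_one : ∀ i j, w i j ≤ 1

theorem isFractionalGraph_adjMatrix (G : SimpleGraph V) [DecidableRel G.Adj] :
    IsFractionalGraph (G.adjMatrix ℝ) where
  symm i j := by simp only [SimpleGraph.adjMatrix_apply, G.adj_comm]
  diag i := by simp
  nonneg i j := by rw [SimpleGraph.adjMatrix_apply]; split_ifs <;> simp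
  le_one i j := by rw [SimpleGraph.adjMatrix_apply]; split_ifs <;> simp

variable [Fintype V] {w : Matrix V V ℝ}

theorem IsFractionalGraph.mulVec_one_sub_sum_le (hw : IsFractionalGraph w) {B : Finset V} {i : V}
    (hi : i ∉ B) : (w *ᵥ 1) i - ∑ j ∈ B, w i j ≤ Fintype.card V - 1 - B.card := by
  classical
  have hiB : i ∈ Bᶜ := Finset.mem_compl.mpr hi
  have hsum : (w *ᵥ 1) i - ∑ j ∈ B, w i j = ∑ j ∈ Bᶜ.erase i, w i j := by
    rw [mulVec, dotProduct_one, ← Finset.sum_add_sum_compl B, ← Finset.add_sum_erase _ _ hiB,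
      hw.diag, zero_add, add_sub_cancel_left]
  have hcard : ((Bᶜ.erase i).card : ℝ) = Fintype.card V - 1 - B.card := by
    rw [Finset.cast_card_erase_of_mem hiB, Finset.card_compl, Nat.cast_sub B.card_le_univ]
    ring
  rw [hsum, ← hcard]
  simpa using Finset.sum_le_card_nsmul _ (w i) 1 fun j _ => hw.le_one i j

theorem IsFractionalGraph.mulVec_one_mem_korenPolytope (hw : IsFractionalGraph w) :
    w *ᵥ 1 ∈ korenPolytope V := by
  intro A B hAB
  have hB : ∑ i ∈ A, ∑ j ∈ B, w i j ≤ ∑ j ∈ B, (w *ᵥ 1) j := by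
    refine Finset.sum_comm.trans_le (Finset.sum_le_sum fun j _ => ?_)
    simp only [mulVec, dotProduct_one, hw.symm _ j]
    exact Finset.sum_le_univ_sum_of_nonneg (hw.nonneg j)
  calc _ ≤ ∑ i ∈ A, (w *ᵥ 1) i - ∑ i ∈ A, ∑ j ∈ B, w i j := sub_le_sub_left hB _
    _ = ∑ i ∈ A, ((w *ᵥ 1) i - ∑ j ∈ B, w i j) := (Finset.sum_sub_distrib _ _).symm
    _ ≤ ∑ _i ∈ A, (Fintype.card V - 1 - B.card : ℝ) := Finset.sum_le_sum fun i hi =>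
      hw.mulVec_one_sub_sum_le (Finset.disjoint_left.mp hAB hi)
    _ = _ := by rw [Finset.sum_const, nsmul_eq_mul]

open Classical in
/-- The degree sequence of `G`, as a real vector. -/
noncomputable def degreeVector (G : SimpleGraph V) (i : V) : ℝ := G.degree i

theorem adjMatrix_mulVec_one (G : SimpleGraph V) [DecidableRel G.Adj] :
    G.adjMatrix ℝ *ᵥ 1 = degreeVector G := by
  ext i
  have h : (G.adjMatrix ℝ *ᵥ Function.const V 1) i = G.degree i := by simp
  rw [degreeVector, show (1 : V → ℝ) = Function.const V 1 from rfl]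
  convert h

theorem degreeVector_mem_korenPolytope (G : SimpleGraph V) : degreeVector G ∈ korenPolytope V := by
  classical
  rw [← adjMatrix_mulVec_one]
  exact (isFractionalGraph_adjMatrix G).mulVec_one_mem_korenPolytope

theorem degreeVector_comap {W : Type*} [Fintype W] (G : SimpleGraph V) (e : W ≃ V) :
    degreeVector (G.comap e) = degreeVector G ∘ e := by
  classical
  ext i
  exact congrArg Nat.cast ((SimpleGraph.Iso.comap e G).degree_eq i).symm

open Classical in
theorem two_mul_dotProduct_degreeVector (c : V → ℝ) (G : SimpleGraph V) :
    2 * (c ⬝ᵥ degreeVector G) = ∑ i, ∑ j, if G.Adj i j then c i + c j else 0 := by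
  have h : c ⬝ᵥ degreeVector G = ∑ i, ∑ j, if G.Adj i j then c i else 0 := by
    simp only [← adjMatrix_mulVec_one, dotProduct, mulVec, SimpleGraph.adjMatrix_apply,
      Pi.one_apply, mul_one, Finset.mul_sum, mul_ite, mul_zero]
  have h' : c ⬝ᵥ degreeVector G = ∑ i, ∑ j, if G.Adj i j then c j else 0 := by
    rw [h, Finset.sum_comm]
    simp only [G.adj_comm]
  rw [two_mul]
  nth_rw 1 [h]
  rw [h']
  simp only [← Finset.sum_add_distrib, ite_add_ite, add_zero]

end FractionalGraphs

section WeightGraphs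

variable {V : Type*}

/-- The graph in which two distinct vertices are adjacent when their weights have a positive sum.
Among all graphs, its degree sequence has the largest pairing with `c`. -/
def weightGraph (c : V → ℝ) : SimpleGraph V where
  Adj i j := i ≠ j ∧ 0 < c i + c j
  symm := ⟨fun i j h => ⟨h.1.symm, add_comm (c i) (c j) ▸ h.2⟩⟩
  loopless := ⟨fun _ h => h.1 rfl⟩

theorem weightGraph_adj {c : V → ℝ} {i j : V} :
    (weightGraph c).Adj i j ↔ i ≠ j ∧ 0 < c i + c j := Iff.rfl

variable [Fintype V]

/-- The support function of the set of degree sequences of graphs on `V`. -/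
noncomputable def supportFun (c : V → ℝ) : ℝ := c ⬝ᵥ degreeVector (weightGraph c)

theorem two_mul_supportFun [DecidableEq V] (c : V → ℝ) :
    2 * supportFun c = ∑ i, ∑ j, if i ≠ j then (c i + c j)⁺ else 0 := by
  classical
  rw [supportFun, two_mul_dotProduct_degreeVector]
  refine Finset.sum_congr rfl fun i _ => Finset.sum_congr rfl fun j _ => ?_
  simp only [weightGraph_adj, ite_and, posPart_eq_ite_lt]

theorem posPart_add_eq_sign_add {a b m : ℝ} (ha : a = 0 ∨ m ≤ |a|)
    (hb : b = 0 ∨ m ≤ |b|) :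
    (a + b)⁺ = m * (SignType.sign a + SignType.sign b : ℝ)⁺ +
      (a - m * SignType.sign a + (b - m * SignType.sign b))⁺ := by
  rcases lt_trichotomy a 0 with h | rfl | h <;> rcases lt_trichotomy b 0 with h' | rfl | h' <;>
  · simp only [*, sign_neg, sign_pos, sign_zero, SignType.coe_neg_one, SignType.coe_one,
      SignType.coe_zero, abs_of_neg, abs_of_pos, ne_of_lt, ne_of_gt, false_or, posPart_def,
      max_def] at *
    split_ifs <;> linarith

theorem supportFun_eq_sign_add {c : V → ℝ} {m : ℝ} (hc : ∀ i, c i = 0 ∨ m ≤ |c i|) :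
    supportFun c = m * supportFun (fun i => (SignType.sign (c i) : ℝ)) +
      supportFun (fun i => c i - m * SignType.sign (c i)) := by
  classical
  refine mul_left_cancel₀ (two_ne_zero' ℝ) ?_
  rw [mul_add, mul_left_comm]
  simp only [two_mul_supportFun, Finset.mul_sum, ← Finset.sum_add_distrib]
  refine Finset.sum_congr rfl fun i _ => Finset.sum_congr rfl fun j _ => ?_
  split_ifs
  · exact posPart_add_eq_sign_add (hc i) (hc j)
  · simp

theorem sign_dotProduct (c x : V → ℝ) :
    (fun i => (SignType.sign (c i) : ℝ)) ⬝ᵥ x =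
      ∑ i with 0 < c i, x i - ∑ i with c i < 0, x i := by
  simp only [dotProduct, Finset.sum_filter, ← Finset.sum_sub_distrib]
  refine Finset.sum_congr rfl fun i _ => ?_
  rcases lt_trichotomy (c i) 0 with h | h | h
  · simp [h, h.not_gt]
  · simp [h]
  · simp [h, h.not_gt]

theorem degreeVector_weightGraph_sign_of_pos {c : V → ℝ} {i : V} (hi : 0 < c i) :
    degreeVector (weightGraph fun i => (SignType.sign (c i) : ℝ)) i =
      Fintype.card V - 1 - Finset.card {j | c j < 0} := by
  classical
  have hadj (j : V) : (weightGraph fun i => (SignType.sign (c i) : ℝ)).Adj i j ↔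
      j ≠ i ∧ ¬ c j < 0 := by
    rw [weightGraph_adj, sign_pos hi, ne_comm]
    rcases lt_trichotomy (c j) 0 with h | h | h
    · simp [h]
    · simp [h]
    · simp [h, h.not_gt]
  have hmem : i ∈ ({j | c j < 0} : Finset V)ᶜ := by simp [hi.le]
  rw [degreeVector, ← SimpleGraph.card_neighborFinset_eq_degree,
    show SimpleGraph.neighborFinset _ i = ({j | c j < 0} : Finset V)ᶜ.erase i by ext j; simp [hadj],
    Finset.cast_card_erase_of_mem hmem, Finset.card_compl, Nat.cast_sub (Finset.card_le_univ _)]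
  ring

theorem degreeVector_weightGraph_sign_of_neg {c : V → ℝ} {i : V} (hi : c i < 0) :
    degreeVector (weightGraph fun i => (SignType.sign (c i) : ℝ)) i = 0 := by
  rw [degreeVector, Nat.cast_eq_zero, SimpleGraph.degree_eq_zero]
  intro j hj
  rw [weightGraph_adj, sign_neg hi] at hj
  rcases lt_trichotomy (c j) 0 with h | h | h <;> norm_num [h] at hj

theorem supportFun_sign (c : V → ℝ) :
    supportFun (fun i => (SignType.sign (c i) : ℝ)) =
      Finset.card {i | 0 < c i} * (Fintype.card V - 1 - Finset.card {i | c i < 0} : ℝ) := by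
  rw [supportFun, sign_dotProduct,
    Finset.sum_congr rfl fun i hi =>
      degreeVector_weightGraph_sign_of_pos (Finset.mem_filter_univ i |>.mp hi),
    Finset.sum_congr rfl fun i hi =>
      degreeVector_weightGraph_sign_of_neg (Finset.mem_filter_univ i |>.mp hi),
    Finset.sum_const, Finset.sum_const_zero, nsmul_eq_mul, sub_zero]

theorem dotProduct_le_supportFun {x : V → ℝ} (hx : x ∈ korenPolytope V) (c : V → ℝ) :
    c ⬝ᵥ x ≤ supportFun c := by
  induction c using sign_induction with
  | zero => simp [supportFun]
  | step c m hm hc ih =>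
    have hsign : (fun i => (SignType.sign (c i) : ℝ)) ⬝ᵥ x ≤
        supportFun fun i => (SignType.sign (c i) : ℝ) := by
      rw [sign_dotProduct, supportFun_sign]
      exact hx _ _ (Finset.disjoint_filter.mpr fun _ _ => lt_asymm)
    have hpeel : c = m • (fun i => (SignType.sign (c i) : ℝ)) +
        fun i => c i - m * SignType.sign (c i) := by
      ext i
      simp
    rw [supportFun_eq_sign_add hc]
    conv_lhs => rw [hpeel]
    rw [add_dotProduct, smul_dotProduct, smul_eq_mul]
    exact add_le_add (mul_le_mul_of_nonneg_left hsign hm) ih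

theorem degreeVector_weightGraph_eq_of_eq {c : V → ℝ} {i j : V} (hij : c i = c j) :
    degreeVector (weightGraph c) i = degreeVector (weightGraph c) j := by
  classical
  have hswap : (weightGraph c).comap (Equiv.swap i j) = weightGraph c := by
    ext k l
    simp only [SimpleGraph.comap_adj, weightGraph_adj, Equiv.apply_swap_eq_self hij, ne_eq,
      EmbeddingLike.apply_eq_iff_eq]
  conv_lhs => rw [← hswap, degreeVector_comap, Function.comp_apply, Equiv.swap_apply_left]

end WeightGraphs

section Threshold

variable {V : Type*}

theorem IsThreshold.comap {W : Type*} {G : SimpleGraph V} (hG : IsThreshold G) (f : W ↪ V) :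
    IsThreshold (G.comap f) := by
  intro s hs
  obtain ⟨⟨_, v, hv, rfl⟩, h⟩ := hG (f '' s) (hs.image f)
  refine ⟨⟨v, hv⟩, h.imp (fun h w hvw => ?_) fun h w => ?_⟩
  · exact @h ⟨f w, w, w.2, rfl⟩ fun heq =>
      hvw (Subtype.ext (f.injective (congrArg Subtype.val heq)))
  · exact h ⟨f w, w, w.2, rfl⟩

/-- The graph `G` restricted to `s` is the weight graph of `c`, and no two distinct vertices of `s`
have weights adding up to zero. This makes `G` the unique maximiser of `c` on degree sequences. -/
def IsGenericWeight (G : SimpleGraph V) (c : V → ℝ) (s : Set V) : Prop :=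
  s.Pairwise fun i j => c i + c j ≠ 0 ∧ (G.Adj i j ↔ 0 < c i + c j)

theorem IsGenericWeight.exists_insert {G : SimpleGraph V} {c : V → ℝ} {s : Set V}
    (hs : IsGenericWeight G c s) (hfin : s.Finite) {v : V} (hv : v ∉ s)
    (hG : (∀ j ∈ s, G.Adj v j) ∨ ∀ j ∈ s, ¬ G.Adj v j) :
    ∃ c : V → ℝ, IsGenericWeight G c (insert v s) := by
  classical
  have hne {j : V} (hj : j ∈ s) : j ≠ v := ne_of_mem_of_not_mem hj hv
  obtain ⟨m, hm⟩ : ∃ m : ℝ, ∀ j ∈ s, |c j| < m :=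
    ((Set.Finite.eventually_all hfin).mpr fun j _ => eventually_gt_atTop |c j|).exists
  have hupdate {a : ℝ} (ha : ∀ j ∈ s, a + c j ≠ 0 ∧ (G.Adj v j ↔ 0 < a + c j)) :
      IsGenericWeight G (Function.update c v a) (insert v s) := by
    refine (Set.pairwise_insert_of_notMem hv).mpr ⟨fun i hi j hj hij => ?_, fun j hj => ⟨?_, ?_⟩⟩
    · simpa [hne hi, hne hj] using hs hi hj hij
    · simpa [hne hj] using ha j hj
    · simpa [hne hj, add_comm, G.adj_comm] using ha j hj
  rcases hG with hG | hG
  · refine ⟨_, hupdate (a := m) fun j hj => ?_⟩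
    have hpos : 0 < m + c j := by linarith [neg_lt_of_abs_lt (hm j hj)]
    exact ⟨hpos.ne', iff_of_true (hG j hj) hpos⟩
  · refine ⟨_, hupdate (a := -m) fun j hj => ?_⟩
    have hneg : -m + c j < 0 := by linarith [lt_of_abs_lt (hm j hj)]
    exact ⟨hneg.ne, iff_of_false (hG j hj) hneg.not_gt⟩

theorem IsThreshold.exists_isGenericWeight [Finite V] {G : SimpleGraph V} (hG : IsThreshold G)
    (s : Set V) : ∃ c : V → ℝ, IsGenericWeight G c s := by
  induction s using WellFoundedLT.induction with
  | _ s ih =>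
    rcases s.eq_empty_or_nonempty with rfl | hs
    · exact ⟨0, Set.pairwise_empty _⟩
    obtain ⟨⟨v, hv⟩, h⟩ := hG s hs
    obtain ⟨c, hc⟩ := ih (s \ {v}) (Set.sdiff_singleton_ssubset.mpr hv)
    have hadj : (∀ j ∈ s \ {v}, G.Adj v j) ∨ ∀ j ∈ s \ {v}, ¬ G.Adj v j :=
      h.imp (fun h j hj => @h ⟨j, hj.1⟩ fun heq => hj.2 (congrArg Subtype.val heq).symm)
        fun h j hj => h ⟨j, hj.1⟩
    rw [← Set.insert_sdiff_self_of_mem hv]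
    exact hc.exists_insert (Set.toFinite _) (fun h => h.2 rfl) hadj

variable [Fintype V]

theorem IsGenericWeight.dotProduct_degreeVector_lt {c : V → ℝ} {G H : SimpleGraph V}
    (hc : IsGenericWeight G c Set.univ) (hne : H ≠ G) :
    c ⬝ᵥ degreeVector H < c ⬝ᵥ degreeVector G := by
  classical
  have hlt (i j : V) (hij : ¬ (H.Adj i j ↔ G.Adj i j)) :
      (if H.Adj i j then c i + c j else 0) < if G.Adj i j then c i + c j else 0 := by
    have hij' : i ≠ j := by
      rintro rfl
      simp at hij
    obtain ⟨h0, hadj⟩ := hc (Set.mem_univ i) (Set.mem_univ j) hij'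
    by_cases hG : G.Adj i j
    · rw [if_neg fun hH => hij (iff_of_true hH hG), if_pos hG]
      exact hadj.mp hG
    · rw [if_pos (not_not.mp fun hH => hij (iff_of_false hH hG)), if_neg hG]
      exact (not_lt.mp (mt hadj.mpr hG)).lt_of_ne h0
  have hle (i j : V) :
      (if H.Adj i j then c i + c j else 0) ≤ if G.Adj i j then c i + c j else 0 := by
    by_cases hij : H.Adj i j ↔ G.Adj i j
    · simp only [hij, le_refl]
    · exact (hlt i j hij).le
  obtain ⟨i, j, hij⟩ : ∃ i j, ¬ (H.Adj i j ↔ G.Adj i j) := by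
    simpa [SimpleGraph.ext_iff, funext_iff] using hne
  refine lt_of_mul_lt_mul_left ?_ (zero_le_two (α := ℝ))
  rw [two_mul_dotProduct_degreeVector, two_mul_dotProduct_degreeVector]
  exact Finset.sum_lt_sum (fun i _ => Finset.sum_le_sum fun j _ => hle i j) ⟨i, Finset.mem_univ i,
    Finset.sum_lt_sum (fun j _ => hle i j) ⟨j, Finset.mem_univ j, hlt i j hij⟩⟩

theorem IsThreshold.eq_of_degreeVector_eq {G H : SimpleGraph V} (hG : IsThreshold G)
    (h : degreeVector H = degreeVector G) : H = G := by
  obtain ⟨c, hc⟩ := hG.exists_isGenericWeight Set.univ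
  by_contra hne
  exact (hc.dotProduct_degreeVector_lt hne).ne (h ▸ rfl)

end Threshold

section Partitions

variable {n : ℕ}

theorem exists_isDegreePartition_iff {x : Fin n → ℝ} {P : SimpleGraph (Fin n) → Prop}
    (hP : ∀ G (σ : Equiv.Perm (Fin n)), P G → P (G.comap σ)) :
    (∃ G d, P G ∧ IsDegreePartition G d ∧ ∀ i, x i = d i) ↔
      Antitone x ∧ ∃ G, P G ∧ degreeVector G = x := by
  constructor
  · rintro ⟨G, d, hG, ⟨hd, σ, hσ⟩, hx⟩
    refine ⟨fun i j hij => ?_, G.comap σ, hP G σ hG, funext fun i => ?_⟩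
    · simpa only [hx, Nat.cast_le] using hd hij
    · rw [degreeVector_comap, hx, hσ]
      rfl
  · rintro ⟨hx, G, hG, rfl⟩
    exact ⟨G, _, hG, ⟨fun i j hij => Nat.cast_le.mp (hx hij), Equiv.refl _, fun i => rfl⟩,
      fun i => rfl⟩

theorem mem_degreePartitions_iff {x : Fin n → ℝ} :
    x ∈ degreePartitions n ↔ Antitone x ∧ ∃ G, degreeVector G = x := by
  have h := exists_isDegreePartition_iff (x := x) (P := fun _ => True) fun _ _ h => h
  simp only [true_and] at h
  exact h

theorem mem_thresholdPartitions_iff {x : Fin n → ℝ} :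
    x ∈ thresholdPartitions n ↔ Antitone x ∧ ∃ G, IsThreshold G ∧ degreeVector G = x :=
  exists_isDegreePartition_iff fun _ σ hG => hG.comap σ.toEmbedding

theorem thresholdPartitions_subset_degreePartitions :
    thresholdPartitions n ⊆ degreePartitions n :=
  fun _ ⟨G, d, _, h⟩ => ⟨G, d, h⟩

theorem degreePartitions_subset_fhmPolytope : degreePartitions n ⊆ fhmPolytope n := by
  intro x hx
  obtain ⟨hanti, G, rfl⟩ := mem_degreePartitions_iff.mp hx
  exact mem_fhmPolytope_iff.mpr ⟨hanti, degreeVector_mem_korenPolytope G⟩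

theorem thresholdPartitions_subset_extremePoints :
    thresholdPartitions n ⊆ Set.extremePoints ℝ (degreePartitionPolytope n) := by
  intro x hx
  obtain ⟨-, G, hG, rfl⟩ := mem_thresholdPartitions_iff.mp hx
  obtain ⟨c, hc⟩ := hG.exists_isGenericWeight Set.univ
  refine mem_extremePoints_convexHull_of_forall_lt (dotProductEquiv ℝ (Fin n) c)
    (thresholdPartitions_subset_degreePartitions hx) fun y hy hne => ?_
  obtain ⟨-, H, rfl⟩ := mem_degreePartitions_iff.mp hy
  exact hc.dotProduct_degreeVector_lt (mt (congrArg degreeVector) hne)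

end Partitions

section Shifted

variable {V : Type*} [Preorder V]

/-- A graph on an ordered vertex set is shifted if moving the endpoints of an edge down yields an
edge again, as long as they remain distinct. -/
def IsShifted (G : SimpleGraph V) : Prop :=
  ∀ ⦃i i' j j' : V⦄, i ≤ i' → j ≤ j' → i ≠ j → G.Adj i' j' → G.Adj i j

theorem isShifted_weightGraph {c : V → ℝ} (hc : Antitone c) : IsShifted (weightGraph c) :=
  fun _ _ _ _ hi hj hne h => ⟨hne, h.2.trans_le (add_le_add (hc hi) (hc hj))⟩

theorem IsShifted.isThreshold {V : Type*} [LinearOrder V] [Finite V] {G : SimpleGraph V}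
    (hG : IsShifted G) : IsThreshold G := by
  intro s hs
  obtain ⟨a, ha, hmin⟩ := Set.exists_min_image s id s.toFinite hs
  obtain ⟨b, hb, hmax⟩ := Set.exists_max_image s id s.toFinite hs
  by_cases hab : G.Adj a b
  · refine ⟨⟨a, ha⟩, .inl ?_⟩
    intro ⟨c, hc⟩ hac
    exact hG le_rfl (hmax c hc) (Subtype.coe_ne_coe.mpr hac) hab
  · refine ⟨⟨b, hb⟩, .inr ?_⟩
    intro ⟨c, hc⟩ (hbc : G.Adj b c)
    refine hab ?_
    rcases eq_or_ne a b with rfl | hne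
    · exact absurd (le_antisymm (hmin c hc) (hmax c hc)) hbc.ne
    · exact hG (hmin c hc) le_rfl hne hbc.symm

/-- A fractional graph on an ordered vertex set whose edge weights do not decrease when the
endpoints of an edge are moved down. -/
structure IsShiftedFractionalGraph (w : Matrix V V ℝ) : Prop extends IsFractionalGraph w where
  mono : ∀ ⦃i i' j j' : V⦄, i ≤ i' → j ≤ j' → i ≠ j → i' ≠ j' → w i' j' ≤ w i j

theorem IsShifted.isShiftedFractionalGraph_adjMatrix {G : SimpleGraph V} [DecidableRel G.Adj]
    (hG : IsShifted G) : IsShiftedFractionalGraph (G.adjMatrix ℝ) where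
  toIsFractionalGraph := isFractionalGraph_adjMatrix G
  mono i i' j j' hi hj hne _ := by
    rw [SimpleGraph.adjMatrix_apply, SimpleGraph.adjMatrix_apply]
    split_ifs with h h'
    · exact le_rfl
    · exact absurd (hG hi hj hne h) h'
    · exact zero_le_one
    · exact le_rfl

variable [Fintype V]

theorem IsShiftedFractionalGraph.antitone_mulVec_one {w : Matrix V V ℝ}
    (hw : IsShiftedFractionalGraph w) : Antitone (w *ᵥ 1) := by
  classical
  intro i j hij
  simp only [mulVec, dotProduct_one]
  rw [← Equiv.sum_comp (Equiv.swap i j)]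
  refine Finset.sum_le_sum fun k _ => ?_
  rcases eq_or_ne k i with rfl | hki
  · rw [Equiv.swap_apply_left, hw.diag, hw.diag]
  rcases eq_or_ne k j with rfl | hkj
  · rw [Equiv.swap_apply_right, hw.symm]
  · rw [Equiv.swap_apply_of_ne_of_ne hki hkj]
    exact hw.mono hij le_rfl hki.symm hkj.symm

theorem IsShifted.antitone_degreeVector {G : SimpleGraph V} (hG : IsShifted G) :
    Antitone (degreeVector G) := by
  classical
  rw [← adjMatrix_mulVec_one]
  exact hG.isShiftedFractionalGraph_adjMatrix.antitone_mulVec_one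

end Shifted

section Polytope

theorem IsShiftedFractionalGraph.mulVec_one_mem_fhmPolytope {n : ℕ} {w : Matrix (Fin n) (Fin n) ℝ}
    (hw : IsShiftedFractionalGraph w) : w *ᵥ 1 ∈ fhmPolytope n :=
  mem_fhmPolytope_iff.mpr ⟨hw.antitone_mulVec_one, hw.mulVec_one_mem_korenPolytope⟩

/-- The set of degree sequences of shifted graphs on `n` vertices, which are weakly decreasing. -/
def shiftedDegrees (n : ℕ) : Set (Fin n → ℝ) := degreeVector '' {G | IsShifted G}

theorem shiftedDegrees_subset_thresholdPartitions (n : ℕ) :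
    shiftedDegrees n ⊆ thresholdPartitions n := by
  rintro _ ⟨G, hG, rfl⟩
  exact mem_thresholdPartitions_iff.mpr ⟨hG.antitone_degreeVector, G, hG.isThreshold, rfl⟩

theorem fhmPolytope_subset_convexHull_shiftedDegrees (n : ℕ) :
    fhmPolytope n ⊆ convexHull ℝ (shiftedDegrees n) := by
  intro x hx
  obtain ⟨hanti, hkoren⟩ := mem_fhmPolytope_iff.mp hx
  have hfin : (shiftedDegrees n).Finite := (Set.toFinite _).image _
  refine mem_of_forall_exists_dotProduct_le (convex_convexHull ℝ _)
    (hfin.isClosed_convexHull ℝ) fun c => ?_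
  obtain ⟨p, hp, hle, heq⟩ := exists_antitone_dotProduct_le c
  refine ⟨degreeVector (weightGraph p),
    subset_convexHull ℝ _ ⟨_, isShifted_weightGraph hp, rfl⟩, ?_⟩
  calc c ⬝ᵥ x ≤ p ⬝ᵥ x := hle x hanti
    _ ≤ p ⬝ᵥ degreeVector (weightGraph p) := dotProduct_le_supportFun hkoren p
    _ = c ⬝ᵥ degreeVector (weightGraph p) :=
      (heq _ fun _ _ => degreeVector_weightGraph_eq_of_eq).symm

theorem degreePartitionPolytope_subset_fhmPolytope (n : ℕ) :
    degreePartitionPolytope n ⊆ fhmPolytope n :=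
  convexHull_min degreePartitions_subset_fhmPolytope (convex_fhmPolytope n)

theorem convexHull_shiftedDegrees_subset_degreePartitionPolytope (n : ℕ) :
    convexHull ℝ (shiftedDegrees n) ⊆ degreePartitionPolytope n :=
  convexHull_mono ((shiftedDegrees_subset_thresholdPartitions n).trans
    thresholdPartitions_subset_degreePartitions)

theorem degreePartitionPolytope_eq_fhmPolytope (n : ℕ) :
    degreePartitionPolytope n = fhmPolytope n :=
  (degreePartitionPolytope_subset_fhmPolytope n).antisymm
    ((fhmPolytope_subset_convexHull_shiftedDegrees n).trans
      (convexHull_shiftedDegrees_subset_degreePartitionPolytope n))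

theorem degreePartitionPolytope_eq_convexHull_shiftedDegrees (n : ℕ) :
    degreePartitionPolytope n = convexHull ℝ (shiftedDegrees n) :=
  ((degreePartitionPolytope_subset_fhmPolytope n).trans
    (fhmPolytope_subset_convexHull_shiftedDegrees n)).antisymm
      (convexHull_shiftedDegrees_subset_degreePartitionPolytope n)

theorem extremePoints_subset_shiftedDegrees (n : ℕ) :
    Set.extremePoints ℝ (degreePartitionPolytope n) ⊆ shiftedDegrees n := by
  rw [degreePartitionPolytope_eq_convexHull_shiftedDegrees]
  exact extremePoints_convexHull_subset

theorem extremePoints_degreePartitionPolytope (n : ℕ) :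
    Set.extremePoints ℝ (degreePartitionPolytope n) = thresholdPartitions n :=
  ((extremePoints_subset_shiftedDegrees n).trans
    (shiftedDegrees_subset_thresholdPartitions n)).antisymm thresholdPartitions_subset_extremePoints

theorem thresholdPartitions_eq_shiftedDegrees (n : ℕ) :
    thresholdPartitions n = shiftedDegrees n :=
  (thresholdPartitions_subset_extremePoints.trans
    (extremePoints_subset_shiftedDegrees n)).antisymm (shiftedDegrees_subset_thresholdPartitions n)

end Polytope

section Count

variable {n : ℕ}

/-- The graph obtained from `G` by adding an isolated last vertex. -/
def addIsolated (G : SimpleGraph (Fin n)) : SimpleGraph (Fin (n + 1)) :=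
  G.map Fin.castSuccEmb

/-- The graph obtained from `G` by adding a dominating first vertex. -/
def addDominating (G : SimpleGraph (Fin n)) : SimpleGraph (Fin (n + 1)) :=
  G.map (Fin.succEmb n) ⊔ SimpleGraph.starGraph 0

theorem addIsolated_adj_castSucc {G : SimpleGraph (Fin n)} {i j : Fin n} :
    (addIsolated G).Adj i.castSucc j.castSucc ↔ G.Adj i j :=
  SimpleGraph.map_adj_apply (f := Fin.castSuccEmb)

theorem not_addIsolated_adj_last {G : SimpleGraph (Fin n)} {i : Fin (n + 1)} :
    ¬ (addIsolated G).Adj (Fin.last n) i := by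
  rintro ⟨-, a, b, -, h, -⟩
  exact (Fin.castSucc_lt_last a).ne h

theorem addDominating_adj_succ {G : SimpleGraph (Fin n)} {i j : Fin n} :
    (addDominating G).Adj i.succ j.succ ↔ G.Adj i j := by
  rw [addDominating, SimpleGraph.sup_adj, SimpleGraph.starGraph_adj, ← Fin.coe_succEmb,
    SimpleGraph.map_adj_apply]
  simp

theorem addDominating_adj_zero {G : SimpleGraph (Fin n)} {i : Fin (n + 1)} (hi : i ≠ 0) :
    (addDominating G).Adj 0 i :=
  .inr (SimpleGraph.starGraph_adj.mpr ⟨hi.symm, .inl rfl⟩)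

theorem addIsolated_injective : Function.Injective (addIsolated (n := n)) :=
  SimpleGraph.map_injective _

theorem addDominating_injective : Function.Injective (addDominating (n := n)) := by
  intro G H h
  ext i j
  rw [← addDominating_adj_succ, h, addDominating_adj_succ]

theorem addIsolated_ne_addDominating (G H : SimpleGraph (Fin (n + 1))) :
    addIsolated G ≠ addDominating H := by
  intro h
  have hadj : (addDominating H).Adj 0 (Fin.last (n + 1)) := addDominating_adj_zero Fin.last_pos.ne'
  exact not_addIsolated_adj_last (h ▸ hadj.symm)

theorem addIsolated_comap_castSucc {G : SimpleGraph (Fin (n + 1))}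
    (hG : ∀ i, ¬ G.Adj (Fin.last n) i) : addIsolated (G.comap Fin.castSucc) = G := by
  ext i j
  induction i using Fin.lastCases with
  | last => exact iff_of_false not_addIsolated_adj_last (hG j)
  | cast i =>
    induction j using Fin.lastCases with
    | last => exact iff_of_false (mt .symm not_addIsolated_adj_last) (mt .symm (hG _))
    | cast j => rw [addIsolated_adj_castSucc, SimpleGraph.comap_adj]

theorem addDominating_comap_succ {G : SimpleGraph (Fin (n + 1))} (hG : ∀ i, i ≠ 0 → G.Adj 0 i) :
    addDominating (G.comap Fin.succ) = G := by
  ext i j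
  rcases eq_or_ne i j with rfl | hij
  · simp
  induction i using Fin.cases with
  | zero => exact iff_of_true (addDominating_adj_zero hij.symm) (hG j hij.symm)
  | succ i =>
    induction j using Fin.cases with
    | zero => exact iff_of_true (addDominating_adj_zero hij).symm (hG _ hij).symm
    | succ j => rw [addDominating_adj_succ, SimpleGraph.comap_adj]

theorem IsShifted.comap {V W : Type*} [Preorder V] [Preorder W] {G : SimpleGraph V}
    (hG : IsShifted G) (f : W ↪o V) : IsShifted (G.comap f) :=
  fun _ _ _ _ hi hj hne h => hG (f.monotone hi) (f.monotone hj) (f.injective.ne hne) h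

theorem isShifted_addIsolated {G : SimpleGraph (Fin n)} (hG : IsShifted G) :
    IsShifted (addIsolated G) := by
  rintro i _ j _ hi hj hne ⟨-, a, b, hab, rfl, rfl⟩
  obtain ⟨i, rfl⟩ := Fin.exists_castSucc_eq.mpr (hi.trans_lt (Fin.castSucc_lt_last a)).ne
  obtain ⟨j, rfl⟩ := Fin.exists_castSucc_eq.mpr (hj.trans_lt (Fin.castSucc_lt_last b)).ne
  exact addIsolated_adj_castSucc.mpr (hG hi hj (ne_of_apply_ne _ hne) hab)

theorem isShifted_addDominating {G : SimpleGraph (Fin n)} (hG : IsShifted G) :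
    IsShifted (addDominating G) := by
  intro i i' j j' hi hj hne h
  induction i using Fin.cases with
  | zero => exact addDominating_adj_zero hne.symm
  | succ i =>
    induction j using Fin.cases with
    | zero => exact (addDominating_adj_zero hne).symm
    | succ j =>
      obtain ⟨i', rfl⟩ := Fin.exists_succ_eq.mpr ((Fin.succ_pos i).trans_le hi).ne'
      obtain ⟨j', rfl⟩ := Fin.exists_succ_eq.mpr ((Fin.succ_pos j).trans_le hj).ne'
      rw [addDominating_adj_succ] at h ⊢
      exact hG (Fin.succ_le_succ_iff.mp hi) (Fin.succ_le_succ_iff.mp hj) (ne_of_apply_ne _ hne) h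

theorem setOf_isShifted_add_two (n : ℕ) :
    {G : SimpleGraph (Fin (n + 2)) | IsShifted G} =
      addIsolated '' {G | IsShifted G} ∪ addDominating '' {G | IsShifted G} := by
  ext G
  constructor
  · intro (hG : IsShifted G)
    by_cases h : G.Adj 0 (Fin.last (n + 1))
    · exact .inr ⟨_, hG.comap (Fin.succOrderEmb _), addDominating_comap_succ fun i hi =>
        hG le_rfl (Fin.le_last i) hi.symm h⟩
    · exact .inl ⟨_, hG.comap Fin.castSuccOrderEmb, addIsolated_comap_castSucc fun i hi =>
        h (hG (Fin.zero_le i) le_rfl Fin.last_pos.ne hi.symm)⟩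
  · rintro (⟨H, hH, rfl⟩ | ⟨H, hH, rfl⟩)
    · exact isShifted_addIsolated hH
    · exact isShifted_addDominating hH

theorem ncard_setOf_isShifted (n : ℕ) :
    {G : SimpleGraph (Fin (n + 1)) | IsShifted G}.ncard = 2 ^ n := by
  induction n with
  | zero =>
    have hall : {G : SimpleGraph (Fin 1) | IsShifted G} = Set.univ :=
      Set.eq_univ_of_forall fun G i _ j _ _ _ hne => absurd (Subsingleton.elim i j) hne
    rw [hall, Set.ncard_univ]
    simp
  | succ n ih =>
    have hdisj : Disjoint (addIsolated '' {G : SimpleGraph (Fin (n + 1)) | IsShifted G})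
        (addDominating '' {G | IsShifted G}) := by
      rw [Set.disjoint_left]
      rintro _ ⟨G, -, rfl⟩ ⟨H, -, h⟩
      exact addIsolated_ne_addDominating G H h.symm
    rw [setOf_isShifted_add_two, Set.ncard_union_eq hdisj,
      Set.ncard_image_of_injective _ addIsolated_injective,
      Set.ncard_image_of_injective _ addDominating_injective, ih, pow_succ, mul_two]

theorem ncard_shiftedDegrees (n : ℕ) : (shiftedDegrees (n + 1)).ncard = 2 ^ n := by
  have hinj : Set.InjOn degreeVector {G : SimpleGraph (Fin (n + 1)) | IsShifted G} :=
    fun _ _ _ (hH : IsShifted _) h => hH.isThreshold.eq_of_degreeVector_eq h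
  rw [shiftedDegrees, hinj.ncard_image, ncard_setOf_isShifted]

theorem fhmIndices_succ (n : ℕ) :
    fhmIndices (n + 1) = fhmIndices n ∪ Finset.HasAntidiagonal.antidiagonal (n + 1) := by
  ext p
  simp only [fhmIndices, Finset.mem_filter, Finset.mem_product, Finset.mem_range,
    Finset.mem_union, Finset.HasAntidiagonal.mem_antidiagonal]
  omega

theorem two_mul_card_fhmIndices (n : ℕ) : 2 * (fhmIndices n).card = n * (n + 3) := by
  induction n with
  | zero => rfl
  | succ n ih =>
    have hdisj : Disjoint (fhmIndices n) (Finset.HasAntidiagonal.antidiagonal (n + 1)) := by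
      rw [Finset.disjoint_left]
      intro p hp
      simp only [fhmIndices, Finset.mem_filter] at hp
      rw [Finset.HasAntidiagonal.mem_antidiagonal]
      omega
    rw [fhmIndices_succ, Finset.card_union_of_disjoint hdisj, Finset.Nat.card_antidiagonal,
      mul_add, ih]
    ring

end Count

section OrderPolytope

theorem convex_orderPolytope (P : Type*) [PartialOrder P] : Convex ℝ (orderPolytope P) := by
  have h : orderPolytope P = {x | ∀ p q : P, p < q → x q ≤ x p} ∩ Set.Icc 0 1 := by
    ext x
    simp only [orderPolytope, Set.mem_ofPred_eq, Set.mem_inter_iff, Set.mem_Icc, Pi.le_def,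
      Pi.zero_apply, Pi.one_apply, forall_and]
  rw [h]
  refine Convex.inter (fun x hx y hy a b ha hb _ p q hpq => ?_) (convex_Icc 0 1)
  exact add_le_add (mul_le_mul_of_nonneg_left (hx p q hpq) ha)
    (mul_le_mul_of_nonneg_left (hy p q hpq) hb)

theorem antitone_of_mem_orderPolytope {P : Type*} [PartialOrder P] {y : P → ℝ}
    (hy : y ∈ orderPolytope P) : Antitone y :=
  fun _ _ h => h.eq_or_lt.elim (fun h => h ▸ le_rfl) (hy.1 _ _)

variable {n : ℕ}

/-- The symmetric matrix with zero diagonal and the given entries above the diagonal. -/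
noncomputable def symmetrize (y : TwoSubset n → ℝ) : Matrix (Fin n) (Fin n) ℝ :=
  fun i j => if h : i ≠ j then y ⟨(min i j, max i j), min_lt_max.mpr h⟩ else 0

theorem symmetrize_of_ne (y : TwoSubset n → ℝ) {i j : Fin n} (h : i ≠ j) :
    symmetrize y i j = y ⟨(min i j, max i j), min_lt_max.mpr h⟩ := dif_pos h

theorem symmetrize_self (y : TwoSubset n → ℝ) (i : Fin n) : symmetrize y i i = 0 :=
  dif_neg (not_not.mpr rfl)

theorem symmetrize_apply_coe (y : TwoSubset n → ℝ) (e : TwoSubset n) :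
    symmetrize y e.val.1 e.val.2 = y e := by
  rw [symmetrize_of_ne y e.2.ne]
  simp only [min_eq_left e.2.le, max_eq_right e.2.le]

theorem isShiftedFractionalGraph_symmetrize {y : TwoSubset n → ℝ}
    (hy : y ∈ orderPolytope (TwoSubset n)) : IsShiftedFractionalGraph (symmetrize y) where
  symm i j := by simp only [symmetrize, min_comm, max_comm, ne_comm]
  diag := symmetrize_self y
  nonneg i j := by
    rw [symmetrize]
    split_ifs
    exacts [(hy.2 _).1, le_rfl]
  le_one i j := by
    rw [symmetrize]
    split_ifs
    exacts [(hy.2 _).2, zero_le_one]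
  mono i i' j j' hi hj hne hne' := by
    rw [symmetrize_of_ne y hne, symmetrize_of_ne y hne']
    exact antitone_of_mem_orderPolytope hy ⟨min_le_min hi hj, max_le_max hi hj⟩

theorem IsShiftedFractionalGraph.mem_orderPolytope {w : Matrix (Fin n) (Fin n) ℝ}
    (hw : IsShiftedFractionalGraph w) :
    (fun e : TwoSubset n => w e.val.1 e.val.2) ∈ orderPolytope (TwoSubset n) :=
  ⟨fun p q h => hw.mono h.le.1 h.le.2 p.2.ne q.2.ne, fun _ => ⟨hw.nonneg _ _, hw.le_one _ _⟩⟩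

theorem incidenceMatrix_mulVec {w : Matrix (Fin n) (Fin n) ℝ} (hsymm : ∀ i j, w i j = w j i)
    (hdiag : ∀ i, w i i = 0) :
    incidenceMatrix n *ᵥ (fun e => w e.val.1 e.val.2) = w *ᵥ 1 := by
  ext i
  have hpairs : (incidenceMatrix n *ᵥ fun e => w e.val.1 e.val.2) i =
      ∑ p : Fin n × Fin n with p.1 < p.2, if i = p.1 ∨ i = p.2 then w p.1 p.2 else 0 := by
    rw [Finset.sum_subtype (p := fun p : Fin n × Fin n => p.1 < p.2)
      (F := inferInstanceAs (Fintype (TwoSubset n))) _ (by simp)]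
    simp [mulVec, dotProduct, incidenceMatrix]
  have hsplit (a b : Fin n) : (if a < b then if i = a ∨ i = b then w a b else 0 else 0) =
      (if i = a then if i < b then w i b else 0 else 0) +
        if i = b then if a < i then w i a else 0 else 0 := by
    rcases eq_or_ne i a with rfl | ha <;> rcases eq_or_ne i b with rfl | hb
    · simp
    · simp [hb]
    · simp [ha, hsymm a i]
    · simp [ha, hb]
  rw [hpairs, Finset.sum_filter, Fintype.sum_prod_type]
  simp only [hsplit, Finset.sum_add_distrib]
  rw [Finset.sum_comm]
  simp only [Finset.sum_ite_eq, Finset.mem_univ, if_true]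
  rw [mulVec, dotProduct_one, ← Finset.sum_add_distrib]
  refine Finset.sum_congr rfl fun j _ => ?_
  rcases lt_trichotomy i j with h | rfl | h
  · simp [h, h.not_gt]
  · simp [hdiag]
  · simp [h, h.not_gt]

theorem incidenceMatrix_mulVec_mem_fhmPolytope {y : TwoSubset n → ℝ}
    (hy : y ∈ orderPolytope (TwoSubset n)) : incidenceMatrix n *ᵥ y ∈ fhmPolytope n := by
  have hw := isShiftedFractionalGraph_symmetrize hy
  have hrestrict : (fun e : TwoSubset n => symmetrize y e.val.1 e.val.2) = y :=
    funext (symmetrize_apply_coe y)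
  rw [← hrestrict, incidenceMatrix_mulVec hw.symm hw.diag]
  exact hw.mulVec_one_mem_fhmPolytope

theorem shiftedDegrees_subset_image_orderPolytope (n : ℕ) :
    shiftedDegrees n ⊆ (incidenceMatrix n *ᵥ ·) '' orderPolytope (TwoSubset n) := by
  classical
  rintro _ ⟨G, hG, rfl⟩
  have hw := IsShifted.isShiftedFractionalGraph_adjMatrix hG
  refine ⟨_, hw.mem_orderPolytope, ?_⟩
  rw [← adjMatrix_mulVec_one]
  exact incidenceMatrix_mulVec hw.symm hw.diag

theorem incidenceMatrix_image_orderPolytope (n : ℕ) :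
    (incidenceMatrix n *ᵥ ·) '' orderPolytope (TwoSubset n) = degreePartitionPolytope n := by
  refine Set.Subset.antisymm ?_ ?_
  · rw [degreePartitionPolytope_eq_fhmPolytope]
    rintro _ ⟨y, hy, rfl⟩
    exact incidenceMatrix_mulVec_mem_fhmPolytope hy
  · rw [degreePartitionPolytope_eq_convexHull_shiftedDegrees]
    exact convexHull_min (shiftedDegrees_subset_image_orderPolytope n)
      ((convex_orderPolytope _).linear_image (incidenceMatrix n).mulVecLin)

end OrderPolytope

end DegreePartition

theorem mainTheorem1 (n : ℕ) (hn : 1 ≤ n) :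
    DegreePartition.degreePartitionPolytope n = DegreePartition.fhmPolytope n ∧
    2 * (DegreePartition.fhmIndices n).card = n * (n + 3) ∧
    Set.extremePoints ℝ (DegreePartition.degreePartitionPolytope n) =
      DegreePartition.thresholdPartitions n ∧
    (Set.extremePoints ℝ (DegreePartition.degreePartitionPolytope n)).ncard = 2 ^ (n - 1) ∧
    (fun y : DegreePartition.TwoSubset n → ℝ =>
        (DegreePartition.incidenceMatrix n).mulVec y) ''
      DegreePartition.orderPolytope (DegreePartition.TwoSubset n) =
        DegreePartition.degreePartitionPolytope n := by
  refine ⟨DegreePartition.degreePartitionPolytope_eq_fhmPolytope n,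
    DegreePartition.two_mul_card_fhmIndices n,
    DegreePartition.extremePoints_degreePartitionPolytope n, ?_,
    DegreePartition.incidenceMatrix_image_orderPolytope n⟩
  obtain ⟨m, rfl⟩ := Nat.exists_eq_add_of_le' hn
  rw [DegreePartition.extremePoints_degreePartitionPolytope,
    DegreePartition.thresholdPartitions_eq_shiftedDegrees,
    DegreePartition.ncard_shiftedDegrees, Nat.add_sub_cancel]
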